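/- Let $(X,d)$ be a non-empty proper metric space. A geodesic bicombing on $X$ is a continuous map $\sigma\colon X\times X\times[0,1]\to X$, $(x,y,t)\mapsto\sigma_{xy}(t)$, such that each $\sigma_{xy}$ is a constant speed geodesic from $x$ to $y$. It is called ccc if it is consistent, i.e. $\mathrm{im}\,\sigma_{\sigma_{xy}(s),\sigma_{xy}(t)}=\sigma_{xy}([s,t])$ for all $x,y\in X$ and $0\le s<t\le1$, and conical, i.e. $d(\sigma_{xy}(t),\sigma_{x'y'}(t))\le(1-t)d(x,x')+t\,d(y,y')$ for all $x,y,x',y'\in X$ and $t\in[0,1]$ (these two conditions imply that $t\mapsto d(\sigma_{xy}(t),\sigma_{x'y'}(t))$ is convex). It is reversible if $\sigma_{xy}(t)=\sigma_{yx}(1-t)$, and, for a group $G$ acting on $X$, it is $G$-equivariant if $g\sigma_{xy}=\sigma_{gx,gy}$ for all $g\in G$. A $\sigma$-ray is an isometric embedding $\xi\colon[0,\infty)\to X$ with $\mathrm{im}\,\sigma_{\xi(0)\xi(t)}=\xi([0,t])$ for all $t\ge0$; two $\sigma$-rays $\xi,\zeta$ are asymptotic if $\sup_{t\ge0}d(\xi(t),\zeta(t))<\infty$.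 For a ccc bicombing $\sigma$, the boundary $\partial_\sigma X$ is the set of asymptoty classes of $\sigma$-rays, with the topology generated, for a basepoint $o\in X$, by the sets $\{[\eta] : \eta \text{ a } \sigma\text{-ray},\ \eta(0)=o,\ d(\eta(t),\xi(t))<\varepsilon\}$, where $\xi$ is a $\sigma$-ray with $\xi(0)=o$, $t\ge0$ and $\varepsilon>0$. (The topology does not depend on $o$.) Let $G$ be a group acting geometrically on $X$, that is, by isometries, with $\{g\in G: gK\cap K\ne\emptyset\}$ finite for every compact $K\subseteq X$, and with compact quotient $G\backslash X$. Let $\sigma$ be a ccc, reversible, $G$-equivariant geodesic bicombing on $X$, let $n\ge0$, and let $A\le G$ be a subgroup isomorphic to $\mathbb{Z}^n$. Then $\partial_\sigma X$ contains a homeomorphic copy of the unit sphere $S^{n-1}\subset\mathbb{R}^n$ (with $S^{-1}=\emptyset$). Moreover, if $A$ has finite index in $G$, then $\partial_\sigma X$ is homeomorphic to $S^{n-1}$. -/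

import Mathlib

open scoped NNReal

/-- A geodesic bicombing on a metric space `X`: a continuous choice, for every ordered pair of
points `x, y`, of a constant speed geodesic `[0,1] → X` from `x` to `y`.
(In particular `X` is a geodesic space.) -/
structure GeodesicBicombing (X : Type*) [MetricSpace X] where
  /-- The `σ`-geodesic from `x` to `y`, evaluated at time `t`. -/
  path : X → X → unitInterval → X
  continuous_path : Continuous (fun p : X × X × unitInterval => path p.1 p.2.1 p.2.2)
  path_zero : ∀ x y, path x y 0 = x
  path_one : ∀ x y, path x y 1 = y
  dist_path : ∀ (x y : X) (s t : unitInterval),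
    dist (path x y s) (path x y t) = |(s : ℝ) - (t : ℝ)| * dist x y

namespace GeodesicBicombing

variable {X : Type*} [MetricSpace X]

/-- Every subsegment of a `σ`-geodesic is the image of the `σ`-geodesic between its endpoints. -/
def IsConsistent (σ : GeodesicBicombing X) : Prop :=
  ∀ (x y : X) (s t : unitInterval), s < t →
    Set.range (σ.path (σ.path x y s) (σ.path x y t)) = σ.path x y '' Set.Icc s t

/-- `d(σ_{xy}(t), σ_{x'y'}(t)) ≤ (1 - t) d(x,x') + t d(y,y')`. -/
def IsConical (σ : GeodesicBicombing X) : Prop :=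
  ∀ (x y x' y' : X) (t : unitInterval),
    dist (σ.path x y t) (σ.path x' y' t) ≤ (1 - (t : ℝ)) * dist x x' + (t : ℝ) * dist y y'

/-- A `ccc` bicombing: consistent and conical. Convexity of the functions
`t ↦ d(σ_{xy}(t), σ_{x'y'}(t))` is a consequence of these two conditions. -/
structure IsCCC (σ : GeodesicBicombing X) : Prop where
  consistent : σ.IsConsistent
  conical : σ.IsConical

/-- `σ_{xy}(t) = σ_{yx}(1 - t)`. -/
def IsReversible (σ : GeodesicBicombing X) : Prop :=
  ∀ (x y : X) (t : unitInterval), σ.path x y t = σ.path y x (unitInterval.symm t)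

/-- `g σ_{xy} = σ_{gx,gy}` for every `g ∈ G`. -/
def IsEquivariant (G : Type*) [Group G] [MulAction G X] (σ : GeodesicBicombing X) : Prop :=
  ∀ (g : G) (x y : X) (t : unitInterval), g • σ.path x y t = σ.path (g • x) (g • y) t

/-- A `σ`-ray: an isometric embedding `ξ : [0,∞) → X` such that `ξ([0,t])` is the image of the
`σ`-geodesic from `ξ(0)` to `ξ(t)`, for every `t ≥ 0`. -/
structure Ray (σ : GeodesicBicombing X) where
  /-- The underlying map `[0,∞) → X`. -/
  toFun : ℝ≥0 → X
  isometry : Isometry toFun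
  range_path : ∀ t : ℝ≥0, Set.range (σ.path (toFun 0) (toFun t)) = toFun '' Set.Icc 0 t

/-- Two `σ`-rays `ξ, ζ` are asymptotic if `sup_t d(ξ(t), ζ(t)) < ∞`. -/
def Asymptotic {σ : GeodesicBicombing X} (ξ ζ : σ.Ray) : Prop :=
  ∃ C : ℝ, ∀ t : ℝ≥0, dist (ξ.toFun t) (ζ.toFun t) ≤ C

theorem asymptotic_equivalence (σ : GeodesicBicombing X) :
    Equivalence (Asymptotic : σ.Ray → σ.Ray → Prop) where
  refl ξ := ⟨0, fun t => by simp⟩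
  symm := by
    rintro ξ ζ ⟨C, h⟩
    exact ⟨C, fun t => by rw [dist_comm]; exact h t⟩
  trans := by
    rintro ξ ζ η ⟨C, h⟩ ⟨D, k⟩
    exact ⟨C + D, fun t => (dist_triangle _ (ζ.toFun t) _).trans (add_le_add (h t) (k t))⟩

/-- The equivalence relation "asymptotic" on `σ`-rays. -/
def asymptoticSetoid (σ : GeodesicBicombing X) : Setoid σ.Ray where
  r := Asymptotic
  iseqv := σ.asymptotic_equivalence

/-- The boundary `∂_σ X`: the set of classes of asymptotic `σ`-rays. The basepoint `o` plays no
role for the underlying set; it is only used to define the topology. -/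
def Boundary (σ : GeodesicBicombing X) (_o : X) : Type _ := Quotient σ.asymptoticSetoid

/-- The class in `∂_σ X` of a `σ`-ray. -/
def Ray.toBoundary {σ : GeodesicBicombing X} (ξ : σ.Ray) (o : X) : σ.Boundary o :=
  Quotient.mk σ.asymptoticSetoid ξ

/-- For a `σ`-ray `ξ` with origin `o`, the set of boundary points represented by a `σ`-ray `η`
with origin `o` such that `d(η(t), ξ(t)) < ε`. -/
def basicSet {σ : GeodesicBicombing X} (o : X) (ξ : σ.Ray) (t : ℝ≥0) (ε : ℝ) :
    Set (σ.Boundary o) :=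
  {y | ∃ η : σ.Ray, η.toFun 0 = o ∧ η.toBoundary o = y ∧ dist (η.toFun t) (ξ.toFun t) < ε}

/-- The topology of `∂_σ X`, generated by the sets `basicSet o ξ t ε`, where `ξ` runs over the
`σ`-rays with origin `o`, and `t ≥ 0`, `ε > 0`. -/
instance (σ : GeodesicBicombing X) (o : X) : TopologicalSpace (σ.Boundary o) :=
  TopologicalSpace.generateFrom
    {U | ∃ (ξ : σ.Ray) (t : ℝ≥0) (ε : ℝ), ξ.toFun 0 = o ∧ 0 < ε ∧ U = basicSet o ξ t ε}

end GeodesicBicombing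

/-- A geometric action: by isometries, proper, and cocompact. -/
structure IsGeometricAction (G X : Type*) [Group G] [MetricSpace X] [MulAction G X] : Prop where
  isometry : ∀ g : G, Isometry (fun x : X => g • x)
  proper : ∀ K : Set X, IsCompact K → {g : G | ((fun x => g • x) '' K ∩ K).Nonempty}.Finite
  cocompact : CompactSpace (Quotient (MulAction.orbitRel G X))

/-! An orbit map of `ℤⁿ`, precomposed with rounding, is shown to be a coarse cone over `ℝⁿ`: the
`σ`-geodesic from `o` to `a • o` passes, at time `t`, within a uniform distance of `b • o` whenever
`b` is a rounding of `t a` (`exists_dist_geod_le`). Rescaling, `R v = lim σ_{o, f(Tv)}(1/T)`, turns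
it into a genuine cone at bounded distance (`exists_isCone`). Its half-lines are `σ`-rays, and their
directions embed the sphere in the boundary; if the orbit is coarsely dense, every ray is asymptotic
to one of them.

The orbit need not be `σ`-convex, so the uniform bound is the hard point. The map `E x = b⁻¹ σ_{x, a
x}(t)` is 1-Lipschitz and commutes with the centralizer of `A`. Applying
`exists_centralizer_dist_le` twice, to generators of `A` and then to generators of this centralizer,
gives `z` in the centre of the centralizer with `z • o` near `E o`. Conicality compares the iterates
of `E` with a random walk of drift `t a - b`, so `E^k o` drifts at bounded speed, and hence so does
`z ^ k • o`. Since `z` is central, its displacement is almost homogeneous (`dist_le_dist_pow`), so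
bounded speed bounds the displacement of `z` itself, and therefore that of `E o`. -/

open Filter Topology in
theorem le_of_forall_le_add_div {x y c : ℝ} (h : ∀ T : ℝ, 1 ≤ T → x ≤ y + c / T) : x ≤ y := by
  have h1 : Tendsto (fun T : ℝ => y + c / T) atTop (𝓝 (y + 0)) :=
    tendsto_const_nhds.add (tendsto_const_nhds.div_atTop tendsto_id)
  rw [add_zero] at h1
  exact ge_of_tendsto h1 ((eventually_ge_atTop 1).mono h)

/-! ### Geodesics and rays of a bicombing -/

namespace GeodesicBicombing

variable {X : Type*} [MetricSpace X]

/-- The `σ`-geodesic from `x` to `y`, with a real parameter projected to `[0,1]`. -/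
noncomputable def geod (σ : GeodesicBicombing X) (x y : X) (t : ℝ) : X :=
  σ.path x y (Set.projIcc 0 1 zero_le_one t)

theorem geod_of_mem (σ : GeodesicBicombing X) (x y : X) {t : ℝ} (ht : t ∈ Set.Icc (0 : ℝ) 1) :
    σ.geod x y t = σ.path x y ⟨t, ht⟩ := by
  rw [geod, Set.projIcc_of_mem zero_le_one ht]

theorem geod_coe (σ : GeodesicBicombing X) (x y : X) (t : unitInterval) :
    σ.geod x y t = σ.path x y t := σ.geod_of_mem x y t.2

@[simp]
theorem geod_zero (σ : GeodesicBicombing X) (x y : X) : σ.geod x y 0 = x := by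
  rw [σ.geod_of_mem x y ⟨le_rfl, zero_le_one⟩]
  exact σ.path_zero x y

@[simp]
theorem geod_one (σ : GeodesicBicombing X) (x y : X) : σ.geod x y 1 = y := by
  rw [σ.geod_of_mem x y ⟨zero_le_one, le_rfl⟩]
  exact σ.path_one x y

theorem dist_geod (σ : GeodesicBicombing X) (x y : X) {s t : ℝ} (hs : s ∈ Set.Icc (0 : ℝ) 1)
    (ht : t ∈ Set.Icc (0 : ℝ) 1) :
    dist (σ.geod x y s) (σ.geod x y t) = |s - t| * dist x y := by
  rw [σ.geod_of_mem x y hs, σ.geod_of_mem x y ht, σ.dist_path]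

theorem dist_geod_left (σ : GeodesicBicombing X) (x y : X) {t : ℝ}
    (ht : t ∈ Set.Icc (0 : ℝ) 1) : dist x (σ.geod x y t) = t * dist x y := by
  have h := σ.dist_geod x y (s := 0) ⟨le_rfl, zero_le_one⟩ ht
  rwa [geod_zero, zero_sub, abs_neg, abs_of_nonneg ht.1] at h

theorem geod_self (σ : GeodesicBicombing X) (x : X) (t : ℝ) : σ.geod x x t = x := by
  have h := σ.dist_geod_left x x (Set.projIcc (0 : ℝ) 1 zero_le_one t).2
  rw [dist_self, mul_zero, geod_coe] at h
  exact (dist_eq_zero.1 h).symm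

variable {σ : GeodesicBicombing X}

theorem IsConical.dist_geod_le (h : σ.IsConical) (x y x' y' : X) {t : ℝ}
    (ht : t ∈ Set.Icc (0 : ℝ) 1) :
    dist (σ.geod x y t) (σ.geod x' y' t) ≤ (1 - t) * dist x x' + t * dist y y' := by
  rw [σ.geod_of_mem x y ht, σ.geod_of_mem x' y' ht]
  exact h x y x' y' ⟨t, ht⟩

theorem IsConical.dist_geod_le_of_left (h : σ.IsConical) (x y y' : X) {t : ℝ}
    (ht : t ∈ Set.Icc (0 : ℝ) 1) :
    dist (σ.geod x y t) (σ.geod x y' t) ≤ t * dist y y' := by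
  simpa using h.dist_geod_le x y x y' ht

/-- Consistency only compares images; the parameter is recovered from the distance to `x`. -/
theorem IsConsistent.geod_geod (h : σ.IsConsistent) (x y : X) {t u : ℝ}
    (ht : t ∈ Set.Icc (0 : ℝ) 1) (hu : u ∈ Set.Icc (0 : ℝ) 1) :
    σ.geod x (σ.geod x y t) u = σ.geod x y (u * t) := by
  rcases ht.1.eq_or_lt with rfl | h0
  · simp [geod_self]
  have h1 := h x y 0 ⟨t, ht⟩ (Subtype.mk_lt_mk.2 h0)
  rw [σ.path_zero, ← σ.geod_of_mem x y ht] at h1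
  have h2 : σ.geod x (σ.geod x y t) u ∈ σ.path x y '' Set.Icc 0 ⟨t, ht⟩ := by
    rw [← h1, σ.geod_of_mem _ _ hu]
    exact ⟨_, rfl⟩
  obtain ⟨s, -, hs⟩ := h2
  have h3 := σ.dist_geod_left x (σ.geod x y t) hu
  rw [σ.dist_geod_left x y ht, ← hs, ← σ.geod_coe, σ.dist_geod_left x y s.2, ← mul_assoc] at h3
  rw [← hs, ← σ.geod_coe]
  rcases eq_or_ne (dist x y) 0 with h4 | h4
  · rw [dist_eq_zero] at h4
    subst h4
    simp [geod_self]
  · rw [mul_right_cancel₀ h4 h3]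

theorem Ray.geod_eq (ξ : σ.Ray) (t : ℝ≥0) {u : ℝ≥0} (hu : u ≤ 1) :
    σ.geod (ξ.toFun 0) (ξ.toFun t) u = ξ.toFun (u * t) := by
  have hu' : (u : ℝ) ∈ Set.Icc (0 : ℝ) 1 := ⟨u.2, by exact_mod_cast hu⟩
  have h2 : σ.geod (ξ.toFun 0) (ξ.toFun t) u ∈ ξ.toFun '' Set.Icc 0 t := by
    rw [← ξ.range_path, σ.geod_of_mem _ _ hu']
    exact ⟨_, rfl⟩
  obtain ⟨s, -, hs⟩ := h2
  have h3 := σ.dist_geod_left (ξ.toFun 0) (ξ.toFun t) hu'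
  rw [← hs, ξ.isometry.dist_eq, ξ.isometry.dist_eq, NNReal.dist_eq, NNReal.dist_eq] at h3
  simp only [NNReal.coe_zero, zero_sub, abs_neg, NNReal.abs_eq] at h3
  rw [← hs]
  congr 1
  exact_mod_cast h3

/-- Conicality contracts the bounded gap at time `T t` by the factor `1 / T`, and `T` is arbitrary.
-/
theorem Ray.toFun_eq_of_asymptotic (hc : σ.IsConical) {ξ η : σ.Ray}
    (h0 : ξ.toFun 0 = η.toFun 0) (h : Asymptotic ξ η) : ξ.toFun = η.toFun := by
  obtain ⟨C, hC⟩ := h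
  funext t
  refine dist_le_zero.1 (le_of_forall_le_add_div (c := C) fun T hT => ?_)
  lift T to ℝ≥0 using zero_le_one.trans hT
  have hT1 : 1 ≤ T := by exact_mod_cast hT
  have hT0 : T ≠ 0 := (zero_lt_one.trans_le hT1).ne'
  have hi : T⁻¹ ≤ 1 := inv_le_one_of_one_le₀ hT1
  have e1 := ξ.geod_eq (T * t) hi
  have e2 := η.geod_eq (T * t) hi
  rw [inv_mul_cancel_left₀ hT0] at e1 e2
  rw [← e1, ← e2, ← h0, zero_add, div_eq_inv_mul]
  refine (hc.dist_geod_le_of_left _ _ _ ⟨by positivity, by exact_mod_cast hi⟩).trans ?_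
  push_cast
  exact mul_le_mul_of_nonneg_left (hC _) (by positivity)

end GeodesicBicombing

/-! ### Cones over a normed space and the sphere of directions -/

namespace GeodesicBicombing

open Filter Topology

variable {X : Type*} [MetricSpace X] {σ : GeodesicBicombing X}
variable {V : Type*} [NormedAddCommGroup V] [NormedSpace ℝ V]

/-- A continuous, coarsely expanding map `R : V → X` such that each `σ`-geodesic from `o` to
`R v` is the image of the segment from `0` to `v`. -/
structure IsCone (σ : GeodesicBicombing X) (o : X) (R : V → X) : Prop where
  geod_eq : ∀ v, ∀ t ∈ Set.Icc (0 : ℝ) 1, σ.geod o (R v) t = R (t • v)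
  continuous : Continuous R
  norm_le : ∀ B : ℝ, ∃ B' : ℝ, ∀ v w, dist (R v) (R w) ≤ B → ‖v - w‖ ≤ B'

namespace IsCone

variable {o : X} {R : V → X}

theorem map_zero (h : IsCone σ o R) : R 0 = o := by
  have := h.geod_eq 0 0 ⟨le_rfl, zero_le_one⟩
  rw [geod_zero, zero_smul] at this
  exact this.symm

theorem dist_smul (h : IsCone σ o R) (v : V) {s t : ℝ} (hs : 0 ≤ s) (ht : 0 ≤ t) :
    dist (R (s • v)) (R (t • v)) = |s - t| * dist o (R v) := by
  -- Large enough for `s`, `t` and `1` to be parameters on the single geodesic from `o` to `R (M •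
  -- v)`.
  set M : ℝ := s + t + 1
  have hM : 0 < M := by positivity
  have key : ∀ r : ℝ, 0 ≤ r → r ≤ M →
      r / M ∈ Set.Icc (0 : ℝ) 1 ∧ R (r • v) = σ.geod o (R (M • v)) (r / M) := by
    intro r hr hrM
    have hm : r / M ∈ Set.Icc (0 : ℝ) 1 := ⟨by positivity, (div_le_one hM).2 hrM⟩
    refine ⟨hm, ?_⟩
    rw [h.geod_eq _ _ hm, smul_smul, div_mul_cancel₀ _ hM.ne']
  obtain ⟨ms, es⟩ := key s hs (by simp only [M]; linarith)
  obtain ⟨mt, et⟩ := key t ht (by simp only [M]; linarith)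
  obtain ⟨m1, e1⟩ := key 1 zero_le_one (by simp only [M]; linarith)
  rw [one_smul] at e1
  rw [es, et, e1, σ.dist_geod _ _ ms mt, σ.dist_geod_left _ _ m1, ← sub_div, abs_div,
    abs_of_pos hM]
  ring

/-- Otherwise the whole half-line through `v` would collapse to `o`, against coarse expansion. -/
theorem dist_pos (h : IsCone σ o R) {v : V} (hv : v ≠ 0) : 0 < dist o (R v) := by
  refine dist_nonneg.lt_of_ne fun h0 => ?_
  obtain ⟨B, hB⟩ := h.norm_le 0
  have hB0 : 0 ≤ B := (norm_nonneg _).trans (hB 0 0 (by simp))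
  have hv' : 0 < ‖v‖ := norm_pos_iff.2 hv
  have hs : 0 ≤ (B + 1) / ‖v‖ := by positivity
  have h1 := hB (((B + 1) / ‖v‖) • v) ((0 : ℝ) • v) (by
    rw [h.dist_smul v hs le_rfl, ← h0, mul_zero])
  rw [zero_smul, sub_zero, norm_smul, Real.norm_of_nonneg hs, div_mul_cancel₀ _ hv'.ne'] at h1
  linarith

/-- The `σ`-ray `r ↦ R (r v)`. -/
def ray (h : IsCone σ o R) (v : V) (hv : dist o (R v) = 1) : σ.Ray where
  toFun r := R ((r : ℝ) • v)
  isometry := Isometry.of_dist_eq fun s t => by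
    rw [h.dist_smul v s.coe_nonneg t.coe_nonneg, hv, mul_one, NNReal.dist_eq]
  range_path t := by
    have e : ∀ u : unitInterval, σ.path o (R ((t : ℝ) • v)) u = R (((u : ℝ) * t) • v) := by
      intro u
      rw [← geod_coe, h.geod_eq _ _ u.2, smul_smul]
    ext x
    simp only [NNReal.coe_zero, zero_smul, h.map_zero, Set.mem_range, Set.mem_image, e]
    constructor
    · rintro ⟨⟨u, hu0, hu1⟩, rfl⟩
      lift u to ℝ≥0 using hu0
      exact ⟨u * t, ⟨bot_le, mul_le_of_le_one_left bot_le (by exact_mod_cast hu1)⟩, by simp⟩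
    · rintro ⟨s, ⟨-, hs⟩, rfl⟩
      have hs' : (s : ℝ) ≤ t := by exact_mod_cast hs
      refine ⟨⟨(s : ℝ) / t, by positivity, div_le_one_of_le₀ hs' t.coe_nonneg⟩, ?_⟩
      rcases eq_or_ne (t : ℝ) 0 with h0 | h0
      · have hs0 : (s : ℝ) = 0 := le_antisymm (h0 ▸ hs') s.coe_nonneg
        simp [h0, hs0]
      · simp [div_mul_cancel₀ _ h0]

theorem dist_inv_smul (h : IsCone σ o R) {v : V} (hv : v ≠ 0) :
    dist o (R ((dist o (R v))⁻¹ • v)) = 1 := by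
  have h0 := h.dist_pos hv
  have h1 := h.dist_smul v le_rfl (inv_nonneg.2 h0.le)
  rwa [zero_smul, h.map_zero, zero_sub, abs_neg, abs_of_pos (inv_pos.2 h0),
    inv_mul_cancel₀ h0.ne'] at h1

/-- The `σ`-ray in the direction of `v ≠ 0`. -/
noncomputable def dirRay (h : IsCone σ o R) (v : V) (hv : v ≠ 0) : σ.Ray :=
  h.ray ((dist o (R v))⁻¹ • v) (h.dist_inv_smul hv)

theorem dirRay_toFun (h : IsCone σ o R) (v : V) (hv : v ≠ 0) (r : ℝ≥0) :
    (h.dirRay v hv).toFun r = R ((r : ℝ) • (dist o (R v))⁻¹ • v) := rfl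

theorem dirRay_zero (h : IsCone σ o R) (v : V) (hv : v ≠ 0) :
    (h.dirRay v hv).toFun 0 = o := by
  simp [dirRay_toFun, h.map_zero]

omit [NormedSpace ℝ V] in
theorem ne_zero_of_mem_sphere (v : Metric.sphere (0 : V) 1) : (v : V) ≠ 0 := by
  intro h
  have := v.2
  simp [h] at this

/-- The boundary point in the direction of a unit vector. -/
noncomputable def sphereMap (h : IsCone σ o R) (v : Metric.sphere (0 : V) 1) : σ.Boundary o :=
  (h.dirRay v (ne_zero_of_mem_sphere v)).toBoundary o

theorem sphereMap_mem_basicSet (h : IsCone σ o R) (hc : σ.IsConical)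
    (v : Metric.sphere (0 : V) 1) (ξ : σ.Ray) (t : ℝ≥0) (ε : ℝ) :
    h.sphereMap v ∈ basicSet o ξ t ε ↔
      dist ((h.dirRay v (ne_zero_of_mem_sphere v)).toFun t) (ξ.toFun t) < ε := by
  constructor
  · rintro ⟨η, h0, h1, h2⟩
    have h3 : Asymptotic η (h.dirRay v (ne_zero_of_mem_sphere v)) :=
      Quotient.exact (s := σ.asymptoticSetoid) h1
    rwa [Ray.toFun_eq_of_asymptotic hc (h0.trans (h.dirRay_zero _ _).symm) h3] at h2
  · intro h2
    exact ⟨_, h.dirRay_zero _ _, rfl, h2⟩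

theorem continuous_sphereMap (h : IsCone σ o R) (hc : σ.IsConical) :
    Continuous h.sphereMap := by
  refine continuous_generateFrom_iff.2 ?_
  rintro _ ⟨ξ, t, ε, -, -, rfl⟩
  have e : h.sphereMap ⁻¹' basicSet o ξ t ε =
      {v : Metric.sphere (0 : V) 1 | dist (R ((t : ℝ) • (dist o (R v))⁻¹ • (v : V))) (ξ.toFun t) < ε} := by
    ext v
    exact h.sphereMap_mem_basicSet hc v ξ t ε
  rw [e]
  have hR := h.continuous
  have h1 : Continuous fun v : Metric.sphere (0 : V) 1 => (dist o (R v))⁻¹ :=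
    Continuous.inv₀ (by fun_prop) fun v => (h.dist_pos (ne_zero_of_mem_sphere v)).ne'
  exact isOpen_lt (by fun_prop) continuous_const

theorem eq_of_bounded (h : IsCone σ o R) {u v : V} {B : ℝ}
    (hB : ∀ t : ℝ≥0, dist (R ((t : ℝ) • u)) (R ((t : ℝ) • v)) ≤ B) : u = v := by
  obtain ⟨B', hB'⟩ := h.norm_le B
  have h1 : ∀ t : ℝ≥0, t * ‖u - v‖ ≤ B' := by
    intro t
    have := hB' _ _ (hB t)
    rwa [← smul_sub, norm_smul, Real.norm_of_nonneg t.coe_nonneg] at this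
  rw [← sub_eq_zero, ← norm_le_zero_iff]
  refine le_of_forall_le_add_div (c := B') fun T hT => ?_
  lift T to ℝ≥0 using zero_le_one.trans hT
  rw [zero_add, le_div_iff₀ (by positivity), mul_comm]
  exact h1 T

theorem injective_sphereMap (h : IsCone σ o R) : Function.Injective h.sphereMap := by
  intro v w hvw
  obtain ⟨B, hB⟩ : Asymptotic _ _ := Quotient.exact (s := σ.asymptoticSetoid) hvw
  have h1 := h.eq_of_bounded hB
  have hv := h.dist_pos (ne_zero_of_mem_sphere v)
  have hw := h.dist_pos (ne_zero_of_mem_sphere w)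
  have h2 := congrArg norm h1
  rw [norm_smul, norm_smul, norm_eq_of_mem_sphere, norm_eq_of_mem_sphere, mul_one, mul_one,
    Real.norm_of_nonneg (inv_nonneg.2 hv.le), Real.norm_of_nonneg (inv_nonneg.2 hw.le)] at h2
  rw [h2] at h1
  exact Subtype.ext (smul_right_injective V (inv_pos.2 hw).ne' h1)

/-- A continuous injection of a compact space into a Hausdorff one. Only the range has to be
Hausdorff: two rays that differ at time `t` are separated by balls of half their distance there. -/
theorem isEmbedding_sphereMap [ProperSpace V] (h : IsCone σ o R) (hc : σ.IsConical) :
    IsEmbedding h.sphereMap := by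
  have hT2 : T2Space (Set.range h.sphereMap) := by
    refine ⟨?_⟩
    rintro ⟨_, v, rfl⟩ ⟨_, w, rfl⟩ hvw
    have hne : v ≠ w := fun e => hvw (by rw [e])
    have hfun : ∃ t, (h.dirRay v (ne_zero_of_mem_sphere v)).toFun t ≠
        (h.dirRay w (ne_zero_of_mem_sphere w)).toFun t := by
      by_contra! hall
      exact hne (h.injective_sphereMap (Quotient.sound (s := σ.asymptoticSetoid)
        ⟨0, fun t => (dist_eq_zero.2 (hall t)).le⟩))
    obtain ⟨t, ht⟩ := hfun
    have hε := half_pos (_root_.dist_pos.2 ht)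
    set ε := dist ((h.dirRay v (ne_zero_of_mem_sphere v)).toFun t)
      ((h.dirRay w (ne_zero_of_mem_sphere w)).toFun t) / 2 with hεd
    have hopen : ∀ u : Metric.sphere (0 : V) 1, IsOpen (Subtype.val ⁻¹'
        (basicSet o (h.dirRay u (ne_zero_of_mem_sphere u)) t ε) :
          Set (Set.range h.sphereMap)) := fun u =>
      IsOpen.preimage continuous_subtype_val (TopologicalSpace.isOpen_generateFrom_of_mem
        ⟨_, t, ε, h.dirRay_zero _ _, hε, rfl⟩)
    refine ⟨_, _, hopen v, hopen w, ?_, ?_, ?_⟩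
    · exact (h.sphereMap_mem_basicSet hc _ _ _ _).2 (by rwa [dist_self])
    · exact (h.sphereMap_mem_basicSet hc _ _ _ _).2 (by rwa [dist_self])
    · rw [Set.disjoint_left]
      rintro ⟨_, u, rfl⟩ h1 h2
      have h1' := (h.sphereMap_mem_basicSet hc _ _ _ _).1 h1
      have h2' := (h.sphereMap_mem_basicSet hc _ _ _ _).1 h2
      have h3 := dist_triangle_left ((h.dirRay v (ne_zero_of_mem_sphere v)).toFun t)
        ((h.dirRay w (ne_zero_of_mem_sphere w)).toFun t)
        ((h.dirRay u (ne_zero_of_mem_sphere u)).toFun t)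
      linarith
  have hcont : Continuous (Set.rangeFactorization h.sphereMap) :=
    (h.continuous_sphereMap hc).subtype_mk _
  have hinj : Function.Injective (Set.rangeFactorization h.sphereMap) := fun v w e =>
    h.injective_sphereMap (congrArg Subtype.val e)
  exact IsEmbedding.subtypeVal.comp (hcont.isClosedEmbedding hinj).isEmbedding

/-- Approximate points far out on the ray by points of the cone, scale back to unit time, and take a
limit direction by compactness. -/
theorem surjective_sphereMap [ProperSpace V] (h : IsCone σ o R) (hc : σ.IsConical)
    {D : ℝ} (hD : ∀ x, ∃ v, dist (R v) x ≤ D) : Function.Surjective h.sphereMap := by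
  intro y
  obtain ⟨ζ, rfl⟩ : ∃ ζ : σ.Ray, ζ.toBoundary o = y := Quotient.exists_rep y
  choose v hv using fun k : ℕ => hD (ζ.toFun (k + 1))
  set w : ℕ → V := fun k => ((k : ℝ) + 1)⁻¹ • v k with hw
  have hD0 : 0 ≤ D := dist_nonneg.trans (hv 0)
  set C := dist o (ζ.toFun 0) + D with hC
  have key : ∀ (s : ℝ≥0) (k : ℕ), s ≤ k + 1 → dist (R ((s : ℝ) • w k)) (ζ.toFun s) ≤ C := by
    intro s k hsk
    have hk : ((k : ℝ≥0) + 1) ≠ 0 := by positivity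
    have hu : s * (k + 1 : ℝ≥0)⁻¹ ≤ 1 := by
      rw [← div_eq_mul_inv]
      exact div_le_one_of_le₀ hsk bot_le
    have hu' : ((s * (k + 1 : ℝ≥0)⁻¹ : ℝ≥0) : ℝ) ∈ Set.Icc (0 : ℝ) 1 :=
      ⟨NNReal.coe_nonneg _, by exact_mod_cast hu⟩
    have e1 := ζ.geod_eq (k + 1) hu
    rw [inv_mul_cancel_right₀ hk] at e1
    have e2 := h.geod_eq (v k) _ hu'
    have e3 : ((s * (k + 1 : ℝ≥0)⁻¹ : ℝ≥0) : ℝ) • v k = (s : ℝ) • w k := by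
      rw [hw, smul_smul]
      push_cast
      rfl
    rw [e3] at e2
    rw [← e1, ← e2]
    refine (hc.dist_geod_le _ _ _ _ hu').trans ?_
    refine add_le_add ?_ ?_
    · exact mul_le_of_le_one_left dist_nonneg (sub_le_self _ hu'.1)
    · exact (mul_le_of_le_one_left dist_nonneg hu'.2).trans (hv k)
  obtain ⟨B, hB⟩ := h.norm_le (C + dist (ζ.toFun 1) o)
  have hbd : ∀ k, w k ∈ Metric.closedBall (0 : V) B := by
    intro k
    rw [mem_closedBall_zero_iff, ← sub_zero (w k)]
    refine hB _ _ ?_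
    rw [h.map_zero]
    refine (dist_triangle _ (ζ.toFun 1) _).trans (add_le_add_left ?_ _)
    simpa using key 1 k (by simp)
  obtain ⟨u, -, φ, hφ, hu⟩ := (isCompact_closedBall (0 : V) B).tendsto_subseq hbd
  have hlim : ∀ s : ℝ≥0, dist (R ((s : ℝ) • u)) (ζ.toFun s) ≤ C := by
    intro s
    have hR := h.continuous
    have hcont : Continuous fun x : V => dist (R ((s : ℝ) • x)) (ζ.toFun s) := by fun_prop
    refine le_of_tendsto ((hcont.tendsto u).comp hu) ?_
    obtain ⟨k, hk⟩ := exists_nat_ge s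
    filter_upwards [eventually_ge_atTop k] with j hj
    refine key s (φ j) (hk.trans ?_)
    have : (k : ℝ≥0) ≤ φ j := by exact_mod_cast hj.trans (hφ.id_le j)
    exact this.trans (by simp)
  -- Both sides of the bounded gap grow linearly, so the two speeds agree.
  have hnrm : dist o (R u) = 1 := by
    rw [← sub_eq_zero, ← abs_nonpos_iff]
    refine le_of_forall_le_add_div (c := C + dist o (ζ.toFun 0)) fun T hT => ?_
    have hT0 : 0 < T := by positivity
    lift T to ℝ≥0 using hT0.le
    rw [zero_add, le_div_iff₀ hT0]
    have h1 := hlim T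
    have h2 := h.dist_smul u le_rfl hT0.le
    rw [zero_smul, h.map_zero, zero_sub, abs_neg, abs_of_pos hT0] at h2
    have h3 : dist (ζ.toFun 0) (ζ.toFun T) = T := by
      rw [ζ.isometry.dist_eq, NNReal.dist_eq]
      simp
    have h4 := dist_dist_dist_le o (R ((T : ℝ) • u)) (ζ.toFun 0) (ζ.toFun T)
    rw [h2, h3, Real.dist_eq] at h4
    have h5 : |dist o (R u) - 1| * T = |T * dist o (R u) - T| := by
      rw [← abs_of_pos hT0, ← abs_mul, abs_of_pos hT0]
      ring_nf
    rw [h5]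
    refine h4.trans ?_
    rw [add_comm]
    exact add_le_add_left h1 _
  have hu0 : u ≠ 0 := by
    rintro rfl
    rw [h.map_zero, dist_self] at hnrm
    exact zero_ne_one hnrm
  have hun : 0 < ‖u‖ := norm_pos_iff.2 hu0
  have hs : ‖u‖⁻¹ • u ∈ Metric.sphere (0 : V) 1 := by
    rw [mem_sphere_zero_iff_norm, norm_smul, norm_inv, norm_norm, inv_mul_cancel₀ hun.ne']
  refine ⟨⟨_, hs⟩, Quotient.sound (s := σ.asymptoticSetoid) ⟨C, fun t => ?_⟩⟩
  rw [dirRay_toFun]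
  have h6 := h.dist_smul u le_rfl (inv_nonneg.2 hun.le)
  rw [zero_smul, h.map_zero, zero_sub, abs_neg, abs_of_pos (inv_pos.2 hun), hnrm, mul_one] at h6
  simp only [h6, inv_inv, smul_inv_smul₀ hun.ne']
  exact hlim t

end IsCone

/-! ### Straightening coarse cones -/

/-- A coarse version of a cone in `X` over `V`, based at `o`. -/
structure IsCoarseCone (σ : GeodesicBicombing X) (o : X) (f : V → X) : Prop where
  dist_geod_le : ∃ C : ℝ, ∀ v, ∀ t ∈ Set.Icc (0 : ℝ) 1, dist (σ.geod o (f v) t) (f (t • v)) ≤ C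
  dist_le : ∃ K : ℝ, ∀ v w, dist (f v) (f w) ≤ K * (‖v - w‖ + 1)
  norm_le : ∀ B : ℝ, ∃ B' : ℝ, ∀ v w, dist (f v) (f w) ≤ B → ‖v - w‖ ≤ B'

theorem IsCoarseCone.exists_isCone [CompleteSpace X] {o : X} {f : V → X}
    (h : IsCoarseCone σ o f) (hσ : σ.IsCCC) :
    ∃ R : V → X, IsCone σ o R ∧ ∃ C, ∀ v, dist (f v) (R v) ≤ C := by
  obtain ⟨C, hC⟩ := h.dist_geod_le
  obtain ⟨K, hK⟩ := h.dist_le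
  have hC0 : 0 ≤ C := dist_nonneg.trans (hC 0 0 ⟨le_rfl, zero_le_one⟩)
  have hK0 : 0 ≤ K := by simpa using dist_nonneg.trans (hK 0 0)
  have inv_mem : ∀ T : ℝ, 1 ≤ T → T⁻¹ ∈ Set.Icc (0 : ℝ) 1 := fun T hT =>
    ⟨by positivity, inv_le_one_of_one_le₀ hT⟩
  set q : V → ℝ → X := fun v T => σ.geod o (f (T • v)) T⁻¹ with hq
  have hcau : ∀ v T T', 1 ≤ T → T ≤ T' → dist (q v T) (q v T') ≤ C / T := by
    intro v T T' hT hTT'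
    have hT0 : 0 < T := by positivity
    have hT'0 : 0 < T' := hT0.trans_le hTT'
    have hm : T / T' ∈ Set.Icc (0 : ℝ) 1 := ⟨by positivity, div_le_one_of_le₀ hTT' hT'0.le⟩
    -- By consistency, `q v T'` is the contraction by `1 / T` of a point within `C` of `f (T • v)`;
    -- this gives the Cauchy estimate `C / T`.
    have e : q v T' = σ.geod o (σ.geod o (f (T' • v)) (T / T')) T⁻¹ := by
      rw [hσ.consistent.geod_geod _ _ hm (inv_mem T hT)]
      simp only [hq]
      congr 1
      rw [← mul_div_assoc, inv_mul_cancel₀ hT0.ne', one_div]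
    have h1 := hC (T' • v) _ hm
    rw [smul_smul, div_mul_cancel₀ _ hT'0.ne', dist_comm] at h1
    rw [e, div_eq_inv_mul C T]
    exact (hσ.conical.dist_geod_le_of_left _ _ _ (inv_mem T hT)).trans
      (mul_le_mul_of_nonneg_left h1 (inv_mem T hT).1)
  have hex : ∀ v, ∃ p, ∀ T, 1 ≤ T → dist (q v T) p ≤ C / T := by
    intro v
    have hb : Tendsto (fun k : ℕ => C / ((k : ℝ) + 1)) atTop (𝓝 0) :=
      tendsto_const_nhds.div_atTop (tendsto_atTop_add_const_right _ _ tendsto_natCast_atTop_atTop)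
    have hseq : CauchySeq fun k : ℕ => q v ((k : ℝ) + 1) := by
      refine cauchySeq_of_le_tendsto_0' (fun k : ℕ => C / ((k : ℝ) + 1)) (fun m n hmn => ?_) hb
      exact hcau v _ _ (by linarith [(Nat.cast_nonneg m : (0 : ℝ) ≤ m)]) (by gcongr)
    obtain ⟨p, hp⟩ := cauchySeq_tendsto_of_complete hseq
    refine ⟨p, fun T hT => le_of_tendsto (tendsto_const_nhds.dist hp) ?_⟩
    obtain ⟨k, hk⟩ := exists_nat_ge T
    filter_upwards [eventually_ge_atTop k] with j hj
    have : (k : ℝ) ≤ j := by exact_mod_cast hj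
    exact hcau v T _ hT (by linarith)
  choose R hR using hex
  have hfR : ∀ v, dist (f v) (R v) ≤ C := by
    intro v
    simpa [hq] using hR v 1 le_rfl
  have hgeod : ∀ v, ∀ t ∈ Set.Icc (0 : ℝ) 1, σ.geod o (R v) t = R (t • v) := by
    intro v t ht
    rcases ht.1.eq_or_lt with rfl | ht0
    -- The vertex is separate, since the substitution `T / t` below needs `t > 0`.
    · rw [geod_zero, zero_smul]
      refine dist_le_zero.1 (le_of_forall_le_add_div (c := 2 * C) fun T hT => ?_)
      have h1 := hR 0 T hT
      have h2 := σ.dist_geod_left o (f (T • (0 : V))) (inv_mem T hT)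
      have h3 := hC 0 0 ⟨le_rfl, zero_le_one⟩
      rw [geod_zero, zero_smul] at h3
      rw [smul_zero] at h2
      have h4 : dist o (q 0 T) ≤ C / T := by
        simp only [hq, smul_zero]
        rw [h2, div_eq_inv_mul]
        exact mul_le_mul_of_nonneg_left h3 (inv_mem T hT).1
      refine (dist_triangle _ (q 0 T) _).trans ((add_le_add h4 h1).trans (le_of_eq ?_))
      ring
    · refine dist_le_zero.1 (le_of_forall_le_add_div (c := 2 * t * C) fun T hT => ?_)
      have hT0 : 0 < T := by positivity
      have hTt : 1 ≤ T / t := (one_le_div ht0).2 (ht.2.trans hT)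
      have h1 := hR v T hT
      have h2 := hR (t • v) (T / t) hTt
      have e : q (t • v) (T / t) = σ.geod o (q v T) t := by
        simp only [hq]
        rw [hσ.consistent.geod_geod _ _ (inv_mem T hT) ht, smul_smul, div_mul_cancel₀ _ ht0.ne',
          inv_div, div_eq_mul_inv]
      rw [e] at h2
      have h3 := hσ.conical.dist_geod_le_of_left o (R v) (q v T) ht
      have h4 : t * dist (R v) (q v T) ≤ t * (C / T) := by
        rw [dist_comm]
        exact mul_le_mul_of_nonneg_left h1 ht0.le
      refine (dist_triangle _ (σ.geod o (q v T) t) _).trans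
        ((add_le_add (h3.trans h4) h2).trans (le_of_eq ?_))
      field_simp
      ring
  -- The same scaling removes the additive error from the coarse Lipschitz bound.
  have hlip : ∀ v w, dist (R v) (R w) ≤ K * dist v w := by
    intro v w
    refine le_of_forall_le_add_div (c := 2 * C + K) fun T hT => ?_
    have hT0 : 0 < T := by positivity
    have hi := inv_mem T hT
    have e1 := hgeod (T • v) _ hi
    have e2 := hgeod (T • w) _ hi
    rw [inv_smul_smul₀ hT0.ne'] at e1 e2
    rw [← e1, ← e2]
    refine (hσ.conical.dist_geod_le_of_left _ _ _ hi).trans ?_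
    have h1 : dist (R (T • v)) (R (T • w)) ≤ C + K * (T * dist v w + 1) + C := by
      have h2 := hK (T • v) (T • w)
      rw [← dist_eq_norm, dist_smul₀, Real.norm_of_nonneg hT0.le] at h2
      have h3 := hfR (T • v)
      rw [dist_comm] at h3
      exact (dist_triangle4 _ (f (T • v)) (f (T • w)) _).trans
        (add_le_add (add_le_add h3 h2) (hfR _))
    refine (mul_le_mul_of_nonneg_left h1 hi.1).trans (le_of_eq ?_)
    field_simp
    ring
  refine ⟨R, ⟨hgeod, ?_, fun B => ?_⟩, C, hfR⟩
  · exact (LipschitzWith.of_dist_le_mul (K := ⟨K, hK0⟩) hlip).continuous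
  · obtain ⟨B', hB'⟩ := h.norm_le (C + B + C)
    refine ⟨B', fun v w hvw => hB' v w ?_⟩
    have h1 := hfR w
    rw [dist_comm] at h1
    exact (dist_triangle4 _ (R v) (R w) _).trans (add_le_add (add_le_add (hfR v) hvw) h1)

end GeodesicBicombing

/-! ### Geometric actions and centralizers -/

namespace IsGeometricAction

variable {G X : Type*} [Group G] [MetricSpace X] [MulAction G X]

theorem dist_smul_smul (h : IsGeometricAction G X) (g : G) (x y : X) :
    dist (g • x) (g • y) = dist x y := (h.isometry g).dist_eq x y

theorem dist_mul_smul (h : IsGeometricAction G X) (g g' : G) (x : X) :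
    dist x ((g * g') • x) ≤ dist x (g • x) + dist x (g' • x) := by
  refine (dist_triangle _ (g • x) _).trans (add_le_add_right ?_ _)
  rw [mul_smul, h.dist_smul_smul]

theorem finite_setOf_dist_le [ProperSpace X] (h : IsGeometricAction G X) (o : X) (R : ℝ) :
    {g : G | dist o (g • o) ≤ R}.Finite := by
  refine (h.proper _ (isCompact_closedBall o R)).subset fun g hg => ?_
  have hg' : dist o (g • o) ≤ R := hg
  refine ⟨g • o, ⟨o, ?_, rfl⟩, ?_⟩
  · exact Metric.mem_closedBall_self (dist_nonneg.trans hg')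
  · rwa [Metric.mem_closedBall']

theorem exists_dist_smul_le (h : IsGeometricAction G X) (o : X) :
    ∃ D, ∀ x, ∃ g : G, dist x (g • o) ≤ D := by
  have : ContinuousConstSMul G X := ⟨fun g => (h.isometry g).continuous⟩
  have := h.cocompact
  let _ := MulAction.orbitRel G X
  obtain ⟨k, hk⟩ := (isCompact_univ (X := Quotient (MulAction.orbitRel G X))).elim_directed_cover
    (fun k : ℕ => Quotient.mk _ '' Metric.ball o k)
    (fun k => isOpenMap_quotient_mk'_mul _ Metric.isOpen_ball)
    (by
      intro y _
      obtain ⟨x, rfl⟩ := Quotient.exists_rep y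
      obtain ⟨k, hk⟩ := exists_nat_gt (dist x o)
      exact Set.mem_iUnion.2 ⟨k, x, hk, rfl⟩)
    (directed_of_isDirected_le fun i j hij =>
      Set.image_mono (Metric.ball_subset_ball (by exact_mod_cast hij)))
  refine ⟨k, fun x => ?_⟩
  obtain ⟨y, hy, hyx⟩ := hk (Set.mem_univ (Quotient.mk _ x))
  obtain ⟨g, rfl⟩ : y ∈ MulAction.orbit G x := Quotient.exact hyx
  refine ⟨g⁻¹, ?_⟩
  rw [← h.dist_smul_smul g, smul_inv_smul]
  exact (Metric.mem_ball.1 hy).le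

/-- The centralizer of a finite set `S` acts cocompactly on the set of all points that are moved
by at most `R` by every element of `S`. -/
theorem exists_centralizer_dist_le [ProperSpace X] (h : IsGeometricAction G X) (o : X)
    {S : Set G} (hS : S.Finite) (R : ℝ) :
    ∃ D, ∀ x, (∀ s ∈ S, dist x (s • x) ≤ R) →
      ∃ c ∈ Subgroup.centralizer S, dist x (c • o) ≤ D := by
  obtain ⟨D, hD⟩ := h.exists_dist_smul_le o
  set F : Set G := {g : G | dist o (g • o) ≤ 2 * D + R} with hF
  have hFfin : F.Finite := h.finite_setOf_dist_le o _
  set K : G → S → G := fun g s => g⁻¹ * s * g with hK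
  have := hS.to_subtype
  have hpi : {k : S → G | ∀ s, k s ∈ F}.Finite := Set.Finite.pi' fun _ => hFfin
  -- One representative for each of the finitely many ways of conjugating `S` into `F`. If `g` and
  -- `g'` conjugate `S` in the same way, then `g * g'⁻¹` centralizes `S`.
  obtain ⟨T, -, hT⟩ := Set.exists_subset_bijOn {g | ∀ s, K g s ∈ F} K
  have hTfin : T.Finite := hT.finite_iff_finite.2 (hpi.subset (by
    rintro _ ⟨g, hg, rfl⟩
    exact hg))
  obtain ⟨M, hM⟩ := (hTfin.image fun g => dist o (g⁻¹ • o)).bddAbove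
  refine ⟨D + M, fun x hx => ?_⟩
  obtain ⟨g, hg⟩ := hD x
  have hgF : ∀ s, K g s ∈ F := by
    intro s
    have h1 : dist o (K g s • o) = dist (g • o) ((s : G) • g • o) := by
      rw [← h.dist_smul_smul g o, smul_smul, smul_smul]
      simp only [hK]
      congr 2
      group
    have h2 := hx s s.2
    have h3 := dist_triangle4 (g • o) x ((s : G) • x) ((s : G) • g • o)
    rw [h.dist_smul_smul, dist_comm (g • o) x] at h3
    change dist o (K g s • o) ≤ _
    rw [h1]
    linarith
  obtain ⟨g', hg', he⟩ := hT.surjOn ⟨g, hgF, rfl⟩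
  refine ⟨g * g'⁻¹, Subgroup.mem_centralizer_iff.2 fun s hs => ?_, ?_⟩
  · have h1 : g'⁻¹ * s * g' = g⁻¹ * s * g := congrFun he ⟨s, hs⟩
    calc s * (g * g'⁻¹) = g * (g⁻¹ * s * g) * g'⁻¹ := by group
      _ = g * (g'⁻¹ * s * g') * g'⁻¹ := by rw [h1]
      _ = g * g'⁻¹ * s := by group
  · refine (dist_triangle _ (g • o) _).trans (add_le_add hg ?_)
    rw [mul_smul, h.dist_smul_smul]
    exact hM ⟨g', hg', rfl⟩

theorem exists_dist_le_sum_abs (h : IsGeometricAction G X) (o : X) {n : ℕ}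
    (φ : Multiplicative (Fin n → ℤ) →* G) :
    ∃ L, 0 ≤ L ∧ ∀ a, dist o (φ (.ofAdd a) • o) ≤ ∑ i, L * |(a i : ℝ)| := by
  set N : G → ℝ := fun g => dist o (g • o) with hN
  have hN1 : N 1 = 0 := by simp [hN]
  have hmul : ∀ g g', N (g * g') ≤ N g + N g' := fun g g' => h.dist_mul_smul g g' o
  have hinv : ∀ g, N g⁻¹ = N g := by
    intro g
    simp only [hN]
    rw [← h.dist_smul_smul g, smul_inv_smul, dist_comm]
  have hpow : ∀ g (k : ℕ), N (g ^ k) ≤ N g * k := by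
    intro g k
    induction k with
    | zero => simp [hN1]
    | succ k ih =>
      rw [pow_succ]
      push_cast
      linarith [hmul (g ^ k) g]
  have hzpow : ∀ g (k : ℤ), N (g ^ k) ≤ N g * |(k : ℝ)| := by
    intro g k
    obtain ⟨m, rfl | rfl⟩ := k.eq_nat_or_neg
    · simpa using hpow g m
    · simpa [hinv] using hpow g m
  set e : Fin n → G := fun i => φ (.ofAdd (Pi.single i 1)) with he
  refine ⟨∑ i, N (e i), Finset.sum_nonneg fun i _ => dist_nonneg, fun a => ?_⟩
  have hs : ∀ s : Finset (Fin n), N (φ (.ofAdd (∑ i ∈ s, Pi.single i (a i)))) ≤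
      ∑ i ∈ s, (∑ i, N (e i)) * |(a i : ℝ)| := by
    intro s
    induction s using Finset.induction_on with
    | empty => simp [hN1]
    | insert i s hi ih =>
      rw [Finset.sum_insert hi, Finset.sum_insert hi, ofAdd_add, map_mul]
      refine (hmul _ _).trans (add_le_add ?_ ih)
      have h1 : φ (.ofAdd (Pi.single i (a i))) = e i ^ a i := by
        rw [he, ← map_zpow, ← ofAdd_zsmul, ← Pi.single_smul, smul_eq_mul, mul_one]
      rw [h1]
      refine (hzpow _ _).trans (mul_le_mul_of_nonneg_right ?_ (abs_nonneg _))
      exact Finset.single_le_sum (f := fun i => N (e i)) (fun _ _ => dist_nonneg)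
        (Finset.mem_univ i)
  have h2 := hs Finset.univ
  rwa [Finset.univ_sum_single] at h2

end IsGeometricAction

/-! ### Displacement, the centre of a centralizer, and the random walk -/

namespace GeodesicBicombing

variable {G X : Type*} [Group G] [MetricSpace X] [MulAction G X] {σ : GeodesicBicombing X}

theorem IsEquivariant.smul_geod (h : σ.IsEquivariant G) (g : G) (x y : X) (t : ℝ) :
    g • σ.geod x y t = σ.geod (g • x) (g • y) t := h g x y _

theorem IsReversible.geod_half (h : σ.IsReversible) (x y : X) :
    σ.geod x y (1 / 2) = σ.geod y x (1 / 2) := by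
  have hm : (1 / 2 : ℝ) ∈ Set.Icc (0 : ℝ) 1 := by constructor <;> norm_num
  rw [σ.geod_of_mem _ _ hm, σ.geod_of_mem _ _ hm, h]
  congr 1
  ext
  norm_num [unitInterval.symm]

/-- Sets of bounded displacement are `σ`-convex, so the cocompactness statement applies along
geodesics. -/
theorem dist_geod_smul_le (hc : σ.IsConical)
    (hequiv : σ.IsEquivariant G) {S : Set G} {R : ℝ} {x y : X}
    (hx : ∀ s ∈ S, dist x (s • x) ≤ R) (hy : ∀ s ∈ S, dist y (s • y) ≤ R) {t : ℝ}
    (ht : t ∈ Set.Icc (0 : ℝ) 1) :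
    ∀ s ∈ S, dist (σ.geod x y t) (s • σ.geod x y t) ≤ R := by
  intro s hs
  rw [hequiv.smul_geod]
  refine (hc.dist_geod_le _ _ _ _ ht).trans ?_
  calc _ ≤ (1 - t) * R + t * R := add_le_add
        (mul_le_mul_of_nonneg_left (hx s hs) (sub_nonneg.2 ht.2))
        (mul_le_mul_of_nonneg_left (hy s hs) ht.1)
    _ = R := by ring

theorem dist_smul_le_of_mem_centralizer (hG : IsGeometricAction G X) {S : Set G} {R : ℝ} {x : X}
    (hx : ∀ s ∈ S, dist x (s • x) ≤ R) {c : G} (hc : c ∈ Subgroup.centralizer S) :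
    ∀ s ∈ S, dist (c • x) (s • c • x) ≤ R := by
  intro s hs
  rw [smul_smul, Subgroup.mem_centralizer_iff.1 hc s hs, mul_smul, hG.dist_smul_smul]
  exact hx s hs

/-- The displacement of a central element of the centralizer is, up to a bounded error,
homogeneous. -/
theorem two_mul_dist_le (hG : IsGeometricAction G X) (hc : σ.IsConical)
    (hrev : σ.IsReversible) (hequiv : σ.IsEquivariant G) {o : X} {S : Set G} {R D : ℝ}
    (ho : ∀ s ∈ S, dist o (s • o) ≤ R)
    (hD : ∀ x, (∀ s ∈ S, dist x (s • x) ≤ R) → ∃ c ∈ Subgroup.centralizer S, dist x (c • o) ≤ D)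
    {z : G} (hz : z ∈ Subgroup.centralizer S)
    (hz' : z ∈ Subgroup.centralizer (Subgroup.centralizer S : Set G)) :
    2 * dist o (z • o) ≤ dist o ((z ^ 2) • o) + 4 * D := by
  have hm : (1 / 2 : ℝ) ∈ Set.Icc (0 : ℝ) 1 := by constructor <;> norm_num
  set y := σ.geod o (z • o) (1 / 2) with hy
  obtain ⟨c, hcS, hcD⟩ := hD y (dist_geod_smul_le hc hequiv ho
    (dist_smul_le_of_mem_centralizer hG ho hz) hm)
  have h1 : dist o (z • o) = dist (c • o) (z • c • o) := by
    rw [smul_smul z, ← Subgroup.mem_centralizer_iff.1 hz' c hcS, mul_smul, hG.dist_smul_smul]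
  have h2 : dist (c • o) (z • c • o) ≤ D + dist y (z • y) + D := by
    have h3 := dist_triangle4 (c • o) y (z • y) (z • c • o)
    rw [hG.dist_smul_smul, dist_comm (c • o) y] at h3
    linarith
  -- By reversibility, `y` and `z • y` are midpoints of geodesics issuing from the common point `z •
  -- o`.
  have h4 : dist y (z • y) ≤ 1 / 2 * dist o (z ^ 2 • o) := by
    rw [hy, hequiv.smul_geod, hrev.geod_half o, smul_smul, ← pow_two]
    exact hc.dist_geod_le_of_left _ _ _ hm
  linarith

theorem dist_le_dist_pow (hG : IsGeometricAction G X) (hc : σ.IsConical)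
    (hrev : σ.IsReversible) (hequiv : σ.IsEquivariant G) {o : X} {S : Set G} {R D : ℝ}
    (ho : ∀ s ∈ S, dist o (s • o) ≤ R)
    (hD : ∀ x, (∀ s ∈ S, dist x (s • x) ≤ R) → ∃ c ∈ Subgroup.centralizer S, dist x (c • o) ≤ D)
    {z : G} (hz : z ∈ Subgroup.centralizer S)
    (hz' : z ∈ Subgroup.centralizer (Subgroup.centralizer S : Set G)) (j : ℕ) :
    2 ^ j * dist o (z • o) ≤ dist o ((z ^ 2 ^ j) • o) + (2 ^ j - 1) * (4 * D) := by
  induction j with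
  | zero => simp
  | succ j ih =>
    have h1 := two_mul_dist_le hG hc hrev hequiv ho hD (pow_mem hz (2 ^ j)) (pow_mem hz' (2 ^ j))
    rw [← pow_mul, ← pow_succ] at h1
    rw [pow_succ' (2 : ℝ)]
    linarith

/-- Walk from `o` to `c • o` in steps of length at most `1`. Each point on the way is `D`-close to
the orbit of the centralizer, so consecutive approximating elements differ by a generator. -/
theorem centralizer_le_closure (hG : IsGeometricAction G X) (hc : σ.IsConical)
    (hequiv : σ.IsEquivariant G) {o : X} {S : Set G} {R D : ℝ}
    (ho : ∀ s ∈ S, dist o (s • o) ≤ R)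
    (hD : ∀ x, (∀ s ∈ S, dist x (s • x) ≤ R) →
      ∃ c ∈ Subgroup.centralizer S, dist x (c • o) ≤ D) :
    Subgroup.centralizer S ≤
      Subgroup.closure {s | s ∈ Subgroup.centralizer S ∧ dist o (s • o) ≤ 2 * D + 1} := by
  intro c hcS
  have hD0 : 0 ≤ D := by
    obtain ⟨c', -, h⟩ := hD o ho
    exact dist_nonneg.trans h
  obtain ⟨N, hN⟩ := exists_nat_gt (dist o (c • o))
  have hN0 : (0 : ℝ) < N := dist_nonneg.trans_lt hN
  set x : ℕ → X := fun i => σ.geod o (c • o) (i / N) with hx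
  have hmem : ∀ i, i ≤ N → (i / N : ℝ) ∈ Set.Icc (0 : ℝ) 1 := fun i hi =>
    ⟨by positivity, div_le_one_of_le₀ (by exact_mod_cast hi) hN0.le⟩
  have key : ∀ i, i ≤ N → ∀ c' ∈ Subgroup.centralizer S, dist (x i) (c' • o) ≤ D →
      c' ∈ Subgroup.closure {s | s ∈ Subgroup.centralizer S ∧ dist o (s • o) ≤ 2 * D + 1} := by
    intro i
    induction i with
    | zero =>
      intro _ c' hc' h
      simp only [hx, Nat.cast_zero, zero_div, geod_zero] at h
      exact Subgroup.subset_closure ⟨hc', by linarith⟩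
    | succ i ih =>
      intro hi c' hc' h
      have hi' : i ≤ N := (Nat.le_succ i).trans hi
      obtain ⟨c'', hc'', h''⟩ := hD (x i) (dist_geod_smul_le hc hequiv ho
        (dist_smul_le_of_mem_centralizer hG ho hcS) (hmem i hi'))
      have h1 : dist (x i) (x (i + 1)) ≤ 1 := by
        simp only [hx]
        rw [σ.dist_geod _ _ (hmem i hi') (hmem _ hi), ← sub_div, abs_div]
        push_cast
        rw [sub_add_cancel_left, abs_neg, abs_one, abs_of_pos hN0, div_mul_eq_mul_div, one_mul]
        exact div_le_one_of_le₀ hN.le hN0.le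
      rw [← mul_inv_cancel_left c'' c']
      refine mul_mem (ih hi' c'' hc'' h'') (Subgroup.subset_closure
        ⟨mul_mem (inv_mem hc'') hc', ?_⟩)
      rw [← hG.dist_smul_smul c'', smul_smul, mul_inv_cancel_left]
      have h2 := dist_triangle4 (c'' • o) (x i) (x (i + 1)) (c' • o)
      rw [dist_comm (c'' • o) (x i)] at h2
      linarith
  refine key N le_rfl c hcS ?_
  simp only [hx, div_self hN0.ne', geod_one, dist_self]
  exact hD0

/-- A conical bicombing contracts the distance to a lattice at the speed of a random walk with
drift `t a - b`. -/
theorem dist_iterate_le (hG : IsGeometricAction G X) (hc : σ.IsConical) {o : X} {n : ℕ}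
    (φ : Multiplicative (Fin n → ℤ) →* G) {L : ℝ} (hL0 : 0 ≤ L)
    (hL : ∀ a, dist o (φ (.ofAdd a) • o) ≤ ∑ i, L * |(a i : ℝ)|) (a b : Fin n → ℤ) {t : ℝ}
    (ht : t ∈ Set.Icc (0 : ℝ) 1) {M l : ℝ} (hl : 0 < l) (hM : ∀ i, (a i : ℝ) ^ 2 ≤ M)
    (k : ℕ) (w : Fin n → ℤ) :
    dist ((fun x => (φ (.ofAdd b))⁻¹ • σ.geod x (φ (.ofAdd a) • x) t)^[k] o)
        (φ (.ofAdd w) • o) ≤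
      ∑ i, L * (((w i - k * (t * a i - b i)) ^ 2 + k * M) / (2 * l) + l / 2) := by
  induction k generalizing w with
  | zero =>
    refine (hL w).trans (Finset.sum_le_sum fun i _ => mul_le_mul_of_nonneg_left ?_ hL0)
    simp only [Nat.cast_zero, zero_mul, sub_zero, add_zero]
    rw [div_add_div _ _ (by positivity) two_ne_zero, le_div_iff₀ (by positivity)]
    -- `|w| ≤ w² / (2l) + l / 2`: the quadratic bound replaces the norm because it passes through
    -- the recursion.
    nlinarith [sq_nonneg (|(w i : ℝ)| - l), sq_abs (w i : ℝ)]
  | succ k ih =>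
    rw [Function.iterate_succ_apply']
    set x := (fun x => (φ (.ofAdd b))⁻¹ • σ.geod x (φ (.ofAdd a) • x) t)^[k] o with hx
    have h1 : dist ((φ (.ofAdd b))⁻¹ • σ.geod x (φ (.ofAdd a) • x) t) (φ (.ofAdd w) • o) ≤
        (1 - t) * dist x (φ (.ofAdd (w + b)) • o) +
          t * dist x (φ (.ofAdd (w + b - a)) • o) := by
      have e1 : dist ((φ (.ofAdd b))⁻¹ • σ.geod x (φ (.ofAdd a) • x) t) (φ (.ofAdd w) • o) =
          dist (σ.geod x (φ (.ofAdd a) • x) t)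
            (σ.geod (φ (.ofAdd (w + b)) • o) (φ (.ofAdd (w + b)) • o) t) := by
        rw [geod_self, ← hG.dist_smul_smul (φ (.ofAdd b)), smul_inv_smul, smul_smul, ← map_mul,
          ← ofAdd_add, add_comm b w]
      have e2 : dist (φ (.ofAdd a) • x) (φ (.ofAdd (w + b)) • o) =
          dist x (φ (.ofAdd (w + b - a)) • o) := by
        rw [← hG.dist_smul_smul (φ (.ofAdd a)) x, smul_smul (φ (.ofAdd a)), ← map_mul,
          ← ofAdd_add, add_sub_cancel]
      rw [e1, ← e2]
      exact hc.dist_geod_le _ _ _ _ ht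
    refine h1.trans ((add_le_add (mul_le_mul_of_nonneg_left (ih _) (sub_nonneg.2 ht.2))
      (mul_le_mul_of_nonneg_left (ih _) ht.1)).trans ?_)
    rw [Finset.mul_sum, Finset.mul_sum, ← Finset.sum_add_distrib]
    refine Finset.sum_le_sum fun i _ => ?_
    -- Mean and variance of one step: the mean shifts by the drift, and the variance `t (1 - t) a²`
    -- is at most `M`.
    have hvar : (1 - t) * (((w + b) i : ℤ) - k * (t * a i - b i)) ^ 2 +
        t * (((w + b - a) i : ℤ) - k * (t * a i - b i)) ^ 2 ≤
          (w i - (k + 1) * (t * a i - b i)) ^ 2 + M := by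
      have h2 : t * (1 - t) * (a i : ℝ) ^ 2 ≤ M := by
        refine le_trans (mul_le_of_le_one_left (sq_nonneg _) ?_) (hM i)
        nlinarith [ht.1, ht.2]
      simp only [Pi.add_apply, Pi.sub_apply]
      push_cast
      linarith
    have e3 : ∀ p q : ℝ, (1 - t) * (L * ((p + k * M) / (2 * l) + l / 2)) +
        t * (L * ((q + k * M) / (2 * l) + l / 2)) =
          L * ((((1 - t) * p + t * q) + k * M) / (2 * l) + l / 2) := by
      intro p q
      ring
    rw [e3]
    push_cast
    refine mul_le_mul_of_nonneg_left (add_le_add_left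
      (div_le_div_of_nonneg_right ?_ (by positivity)) _) hL0
    linarith

end GeodesicBicombing

/-! ### Orbits of `ℤⁿ` are coarse cones -/

namespace GeodesicBicombing

variable {G X : Type*} [Group G] [MetricSpace X] [MulAction G X] {σ : GeodesicBicombing X}

theorem map_mem_of_forall_single {n : ℕ} (φ : Multiplicative (Fin n → ℤ) →* G) {H : Subgroup G}
    (h : ∀ i, φ (.ofAdd (Pi.single i 1)) ∈ H) (a : Multiplicative (Fin n → ℤ)) : φ a ∈ H := by
  change a ∈ H.comap φ
  rw [← ofAdd_toAdd a, ← Finset.univ_sum_single a.toAdd, ofAdd_sum]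
  refine prod_mem fun i _ => ?_
  have h1 : Multiplicative.ofAdd (Pi.single i (a.toAdd i) : Fin n → ℤ) =
      .ofAdd (Pi.single i 1) ^ a.toAdd i := by
    rw [← ofAdd_zsmul, ← Pi.single_smul, smul_eq_mul, mul_one]
  rw [h1]
  exact zpow_mem (Subgroup.mem_comap.2 (h i)) _

/-- The `σ`-geodesic between two points of an orbit of an abelian group stays close to the
corresponding segment in the group. -/
theorem exists_dist_geod_le [ProperSpace X] (hG : IsGeometricAction G X) (hc : σ.IsConical)
    (hrev : σ.IsReversible) (hequiv : σ.IsEquivariant G) (o : X) {n : ℕ}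
    (φ : Multiplicative (Fin n → ℤ) →* G) (B : ℝ) :
    ∃ C, ∀ (a b : Fin n → ℤ), ∀ t ∈ Set.Icc (0 : ℝ) 1, (∀ i, |t * a i - b i| ≤ B) →
      dist (σ.geod o (φ (.ofAdd a) • o) t) (φ (.ofAdd b) • o) ≤ C := by
  obtain ⟨L, hL0, hL⟩ := hG.exists_dist_le_sum_abs o φ
  set S : Set G := Set.range fun i : Fin n => φ (.ofAdd (Pi.single i 1)) with hS
  have hSfin : S.Finite := Set.finite_range _
  obtain ⟨R, hR⟩ := (hSfin.image fun s => dist o (s • o)).bddAbove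
  have ho : ∀ s ∈ S, dist o (s • o) ≤ R := fun s hs => hR ⟨s, hs, rfl⟩
  obtain ⟨D, hD⟩ := hG.exists_centralizer_dist_le o hSfin R
  set S' : Set G := {s | s ∈ Subgroup.centralizer S ∧ dist o (s • o) ≤ 2 * D + 1} with hS'
  have hS'fin : S'.Finite := (hG.finite_setOf_dist_le o _).subset fun s hs => hs.2
  obtain ⟨D', hD'⟩ := hG.exists_centralizer_dist_le o hS'fin (2 * D + 1)
  have hcl : Subgroup.centralizer S ≤ Subgroup.closure S' :=
    centralizer_le_closure hG hc hequiv ho hD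
  have hφS : ∀ a, φ a ∈ Subgroup.centralizer S := by
    intro a
    rw [Subgroup.mem_centralizer_iff]
    rintro _ ⟨i, rfl⟩
    rw [← map_mul, ← map_mul, mul_comm]
  have hSS : S ⊆ Subgroup.centralizer S := by
    rintro _ ⟨i, rfl⟩
    exact hφS _
  refine ⟨D' + (4 * D + D' + n * (L * ((B ^ 2 + 1) / 2))), fun a b t ht hab => ?_⟩
  set E : X → X := fun x => (φ (.ofAdd b))⁻¹ • σ.geod x (φ (.ofAdd a) • x) t with hE
  have hEdist : dist (σ.geod o (φ (.ofAdd a) • o) t) (φ (.ofAdd b) • o) = dist (E o) o := by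
    rw [← hG.dist_smul_smul (φ (.ofAdd b)) (E o), hE, smul_inv_smul]
  have hEcomm : ∀ c ∈ Subgroup.centralizer S, ∀ x, E (c • x) = c • E x := by
    intro c hcS x
    have h : ∀ a, c * φ a = φ a * c := fun a =>
      Subgroup.mem_centralizer_iff.1 (map_mem_of_forall_single φ
        (H := Subgroup.centralizer {c}) (fun i => Subgroup.mem_centralizer_iff.2 fun d hd => by
          rw [Set.mem_singleton_iff.1 hd]
          exact (Subgroup.mem_centralizer_iff.1 hcS _ ⟨i, rfl⟩).symm) a) c rfl
    have h' : c * (φ (.ofAdd b))⁻¹ = (φ (.ofAdd b))⁻¹ * c := by rw [← map_inv, h]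
    simp only [hE]
    rw [smul_smul c, h', mul_smul, hequiv.smul_geod c, smul_smul, smul_smul, h]
  have hElip : ∀ x y, dist (E x) (E y) ≤ dist x y := by
    intro x y
    simp only [hE]
    rw [hG.dist_smul_smul]
    refine (hc.dist_geod_le _ _ _ _ ht).trans (le_of_eq ?_)
    rw [hG.dist_smul_smul]
    ring
  -- `E` commutes with each `s ∈ S'` and is 1-Lipschitz, so `E o` is displaced no more than `o`.
  obtain ⟨z, hz, hzD⟩ := hD' (E o) (fun s hs => by
    rw [← hEcomm s hs.1]
    exact (hElip _ _).trans hs.2)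
  have hz' : z ∈ Subgroup.centralizer (Subgroup.centralizer S : Set G) := by
    refine Subgroup.mem_centralizer_iff.2 fun c hcS => ?_
    have h1 : Subgroup.closure S' ≤ Subgroup.centralizer {z} := by
      refine (Subgroup.closure_le _).2 fun s hs => Subgroup.mem_centralizer_iff.2 fun y hy => ?_
      rw [Set.mem_singleton_iff.1 hy]
      exact (Subgroup.mem_centralizer_iff.1 hz s hs).symm
    exact (Subgroup.mem_centralizer_iff.1 (h1 (hcl hcS)) z rfl).symm
  have hzS : z ∈ Subgroup.centralizer S :=
    Subgroup.mem_centralizer_iff.2 fun s hs => Subgroup.mem_centralizer_iff.1 hz' s (hSS hs)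
  have hiter : ∀ k : ℕ, dist (z ^ k • o) (E^[k] o) ≤ k * D' := by
    intro k
    induction k with
    | zero => simp
    | succ k ih =>
      have h1 : ∀ j : ℕ, E (z ^ j • o) = z ^ j • E o := fun j => hEcomm _ (pow_mem hzS j) o
      rw [Function.iterate_succ_apply']
      refine (dist_triangle _ (E (z ^ k • o)) _).trans ?_
      rw [h1, pow_succ, mul_smul, hG.dist_smul_smul, ← h1, dist_comm (z • o)]
      push_cast
      linarith [hElip (z ^ k • o) (E^[k] o)]
  set M : ℝ := ∑ i, (a i : ℝ) ^ 2 with hM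
  have hM0 : 0 ≤ M := Finset.sum_nonneg fun i _ => sq_nonneg _
  have haM : ∀ i, (a i : ℝ) ^ 2 ≤ M := fun i =>
    Finset.single_le_sum (f := fun i => (a i : ℝ) ^ 2) (fun i _ => sq_nonneg _)
      (Finset.mem_univ i)
  -- The choice `l = k` makes the coefficient of `k` depend on `B` only; the dependence on `a`,
  -- through `M`, is confined to a term that does not grow with `k`.
  have hwalk : ∀ k : ℕ, 0 < k →
      dist (E^[k] o) o ≤ k * (n * (L * ((B ^ 2 + 1) / 2))) + n * (L * (M / 2)) := by
    intro k hk
    have hk0 : (0 : ℝ) < k := by exact_mod_cast hk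
    have h1 := dist_iterate_le hG hc φ hL0 hL a b ht hk0 haM k 0
    rw [ofAdd_zero, map_one, one_smul] at h1
    refine h1.trans ?_
    have h2 : ∀ i ∈ Finset.univ, L * (((((0 : Fin n → ℤ) i : ℤ) - k * (t * a i - b i)) ^ 2 + k * M) /
        (2 * k) + k / 2) ≤ k * (L * ((B ^ 2 + 1) / 2)) + L * (M / 2) := by
      intro i _
      have h3 : (t * a i - b i) ^ 2 ≤ B ^ 2 := sq_le_sq.2 ((hab i).trans (le_abs_self B))
      have h4 : L * (((((0 : Fin n → ℤ) i : ℤ) - k * (t * a i - b i)) ^ 2 + k * M) /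
          (2 * k) + k / 2) = k * (L * (((t * a i - b i) ^ 2 + 1) / 2)) + L * (M / 2) := by
        simp only [Pi.zero_apply, Int.cast_zero]
        field_simp
        ring
      rw [h4]
      gcongr
    refine (Finset.sum_le_sum h2).trans (le_of_eq ?_)
    rw [Finset.sum_const, Finset.card_univ, Fintype.card_fin, nsmul_eq_mul]
    ring
  have hD0 : 0 ≤ D := by
    obtain ⟨c', -, h⟩ := hD o ho
    exact dist_nonneg.trans h
  -- Dividing by `2 ^ j` and letting `j` grow eliminates `M`, so the bound is uniform in `a`, `b`
  -- and `t`.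
  have hzo : dist o (z • o) ≤ 4 * D + D' + n * (L * ((B ^ 2 + 1) / 2)) := by
    refine le_of_forall_le_add_div (c := n * (L * (M / 2))) fun T hT => ?_
    obtain ⟨j, hj⟩ := pow_unbounded_of_one_lt T (one_lt_two (α := ℝ))
    have h1 := dist_le_dist_pow hG hc hrev hequiv ho hD hzS hz' j
    have h2 := hiter (2 ^ j)
    have h3 := hwalk (2 ^ j) (by positivity)
    have h4 := dist_triangle_right o (z ^ 2 ^ j • o) (E^[2 ^ j] o)
    rw [dist_comm o (E^[2 ^ j] o)] at h4
    push_cast at h2 h3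
    have hp : (0 : ℝ) < 2 ^ j := by positivity
    have h5 : n * (L * (M / 2)) / 2 ^ j ≤ n * (L * (M / 2)) / T :=
      div_le_div_of_nonneg_left (by positivity) (by positivity) hj.le
    refine le_trans ?_ (add_le_add_right h5 _)
    rw [← sub_le_iff_le_add', le_div_iff₀ hp]
    linarith
  rw [hEdist]
  have h6 := dist_triangle (E o) (z • o) o
  rw [dist_comm (z • o)] at h6
  linarith

/-- An orbit of a free abelian group, as a coarse cone. -/
theorem isCoarseCone_floor [ProperSpace X] (hG : IsGeometricAction G X) (hc : σ.IsConical)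
    (hrev : σ.IsReversible) (hequiv : σ.IsEquivariant G) (o : X) {n : ℕ}
    (φ : Multiplicative (Fin n → ℤ) →* G) (hφ : Function.Injective φ) :
    IsCoarseCone σ o fun v : EuclideanSpace ℝ (Fin n) => φ (.ofAdd fun i => ⌊v i⌋) • o := by
  have hdist : ∀ a b : Fin n → ℤ, dist (φ (.ofAdd a) • o) (φ (.ofAdd b) • o) =
      dist o (φ (.ofAdd (b - a)) • o) := by
    intro a b
    rw [← hG.dist_smul_smul (φ (.ofAdd a)) o, smul_smul, ← map_mul, ← ofAdd_add, add_sub_cancel]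
  have hfloor : ∀ x y : ℝ, |((⌊y⌋ - ⌊x⌋ : ℤ) : ℝ)| ≤ |x - y| + 1 := by
    intro x y
    push_cast
    have h1 := Int.floor_le x
    have h2 := Int.lt_floor_add_one x
    have h3 := Int.floor_le y
    have h4 := Int.lt_floor_add_one y
    rw [abs_le]
    constructor <;> linarith [le_abs_self (x - y), neg_abs_le (x - y)]
  refine ⟨?_, ?_, fun B => ?_⟩
  -- `t ⌊v⌋` and `⌊t v⌋` differ by at most `1` in each coordinate.
  · obtain ⟨C, hC⟩ := exists_dist_geod_le hG hc hrev hequiv o φ 1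
    refine ⟨C, fun v t ht => hC _ _ t ht fun i => ?_⟩
    have h1 := Int.floor_le (v i)
    have h2 := Int.lt_floor_add_one (v i)
    have h3 := Int.floor_le (t * v i)
    have h4 := Int.lt_floor_add_one (t * v i)
    have h5 := mul_le_mul_of_nonneg_left h1 ht.1
    have h6 := mul_le_mul_of_nonneg_left h2.le ht.1
    rw [PiLp.smul_apply, smul_eq_mul, abs_le]
    constructor <;> linarith [ht.2]
  · obtain ⟨L, hL0, hL⟩ := hG.exists_dist_le_sum_abs o φ
    refine ⟨n * L, fun v w => ?_⟩
    rw [hdist]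
    refine (hL _).trans ?_
    have h1 : ∀ i ∈ Finset.univ, L * |(((fun i => ⌊w i⌋) - fun i => ⌊v i⌋ : Fin n → ℤ) i : ℝ)| ≤
        L * (‖v - w‖ + 1) := by
      intro i _
      refine mul_le_mul_of_nonneg_left ((hfloor (v i) (w i)).trans (add_le_add_left ?_ _)) hL0
      simpa using PiLp.norm_apply_le (v - w) i
    refine (Finset.sum_le_sum h1).trans (le_of_eq ?_)
    rw [Finset.sum_const, Finset.card_univ, Fintype.card_fin, nsmul_eq_mul, mul_assoc]
  -- Coarse expansion comes from properness of the action and injectivity of `φ`.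
  · have hfin : {a : Fin n → ℤ | dist o (φ (.ofAdd a) • o) ≤ B}.Finite :=
      (hG.finite_setOf_dist_le o B).preimage
        ((hφ.comp Multiplicative.ofAdd.injective).injOn)
    obtain ⟨M, hM⟩ := (hfin.image fun a => ∑ i, (|(a i : ℝ)| + 1) ^ 2).bddAbove
    refine ⟨√M, fun v w hvw => ?_⟩
    rw [hdist] at hvw
    have h1 := hM ⟨_, hvw, rfl⟩
    rw [EuclideanSpace.norm_eq]
    refine Real.sqrt_le_sqrt (le_trans (Finset.sum_le_sum fun i _ => ?_) h1)
    refine pow_le_pow_left₀ (norm_nonneg _) ?_ 2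
    rw [Real.norm_eq_abs, PiLp.sub_apply, Pi.sub_apply]
    push_cast
    have h1 := Int.floor_le (v i)
    have h2 := Int.lt_floor_add_one (v i)
    have h3 := Int.floor_le (w i)
    have h4 := Int.lt_floor_add_one (w i)
    rw [abs_le]
    constructor <;> linarith [le_abs_self ((⌊w i⌋ : ℝ) - ⌊v i⌋), neg_abs_le ((⌊w i⌋ : ℝ) - ⌊v i⌋)]

end GeodesicBicombing

/-! ### Finite index and conclusion -/

theorem IsGeometricAction.exists_dist_smul_le_of_finiteIndex {G X : Type*} [Group G]
    [MetricSpace X] [MulAction G X] (h : IsGeometricAction G X) (A : Subgroup G) [A.FiniteIndex]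
    (o : X) : ∃ D, ∀ x, ∃ a ∈ A, dist x (a • o) ≤ D := by
  obtain ⟨D, hD⟩ := h.exists_dist_smul_le o
  obtain ⟨M, hM⟩ :=
    (Set.finite_range fun q : G ⧸ A => dist o (q.out⁻¹ • o)).bddAbove
  refine ⟨D + M, fun x => ?_⟩
  obtain ⟨g, hg⟩ := hD x
  set q : G ⧸ A := QuotientGroup.mk g⁻¹ with hq
  have hmem : (q.out)⁻¹ * g⁻¹ ∈ A := QuotientGroup.eq.1 (by rw [QuotientGroup.out_eq', hq])
  have hmem' : g * q.out ∈ A := by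
    have := inv_mem hmem
    rwa [mul_inv_rev, inv_inv, inv_inv] at this
  refine ⟨_, hmem', (dist_triangle _ (g • o) _).trans (add_le_add hg ?_)⟩
  rw [mul_smul, h.dist_smul_smul, ← h.dist_smul_smul q.out⁻¹, inv_smul_smul, dist_comm]
  exact hM ⟨q, rfl⟩

theorem propositionp {G : Type*} [Group G] {X : Type*} [MetricSpace X] [ProperSpace X]
    [MulAction G X] (hG : IsGeometricAction G X)
    (σ : GeodesicBicombing X) (hccc : σ.IsCCC) (hrev : σ.IsReversible)
    (hequiv : σ.IsEquivariant G)
    (n : ℕ) (A : Subgroup G) (hA : Nonempty (A ≃* Multiplicative (Fin n → ℤ))) (o : X) :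
    (∃ f : Metric.sphere (0 : EuclideanSpace ℝ (Fin n)) 1 → σ.Boundary o,
      Topology.IsEmbedding f) ∧
    (A.FiniteIndex →
      Nonempty (σ.Boundary o ≃ₜ Metric.sphere (0 : EuclideanSpace ℝ (Fin n)) 1)) := by
  obtain ⟨e⟩ := hA
  set φ : Multiplicative (Fin n → ℤ) →* G := A.subtype.comp e.symm.toMonoidHom with hφ
  have hinj : Function.Injective φ := A.subtype_injective.comp e.symm.injective
  obtain ⟨R, hR, C, hC⟩ := (GeodesicBicombing.isCoarseCone_floor hG hccc.conical hrev hequiv o φ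
    hinj).exists_isCone hccc
  have hemb := hR.isEmbedding_sphereMap hccc.conical
  refine ⟨⟨_, hemb⟩, fun hfin => ?_⟩
  obtain ⟨D, hD⟩ := hG.exists_dist_smul_le_of_finiteIndex A o
  have hsurj : Function.Surjective hR.sphereMap := by
    refine hR.surjective_sphereMap hccc.conical (D := C + D) fun x => ?_
    obtain ⟨a, ha, hx⟩ := hD x
    -- An integer vector is its own rounding, so the coarse cone hits `a • o` exactly.
    set v : EuclideanSpace ℝ (Fin n) := WithLp.toLp 2 fun i => ((e ⟨a, ha⟩).toAdd i : ℝ) with hv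
    have hva : φ (.ofAdd fun i => ⌊v i⌋) = a := by
      have h1 : (.ofAdd fun i => ⌊v i⌋ : Multiplicative (Fin n → ℤ)) = e ⟨a, ha⟩ := by
        simp only [hv, Int.floor_intCast]
        rfl
      rw [h1]
      simp [hφ]
    have h2 := hC v
    rw [hva] at h2
    refine ⟨v, (dist_triangle_left _ _ (a • o)).trans (add_le_add h2 ?_)⟩
    rwa [dist_comm]
  exact ⟨(hemb.toHomeomorphOfSurjective hsurj).symm⟩
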